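/- Let $V$ be a real Euclidean space of dimension $n$ with inner product $\langle\cdot,\cdot\rangle$, orthonormal basis $e_1,\dots,e_n$ and unit sphere $S(V)$. Let $\{J_1,\dots,J_l\}$ be a partition of $\{1,\dots,m\}$ into non-empty sets, and let $x_1,\dots,x_l$ be independent random vectors in $S(V)$, each with $O(V)$-invariant (that is, uniform) distribution. Let $X = x_1(J_1)\otimes\cdots\otimes x_l(J_l)\in V^{\otimes m}$ be the decomposable tensor that has the vector $x_i$ at every position $j\in J_i$, for $i=1,\dots,l$. A pairing of a finite set $J$ is a partition of $J$ into two-element sets. For a pairing $\mathcal{P}=\{Q_1,\dots,Q_k\}$ of $J$ put $$I(\mathcal{P})=\sum_{i_1,\dots,i_k=1}^{n} e_{i_1}(Q_1)\otimes\cdots\otimes e_{i_k}(Q_k)\in V^{\otimes J},$$ where again $e_{i_r}$ stands at the two positions in $Q_r$. For tensors $T_i\in V^{\otimes J_i}$, write $T_1\otimes\cdots\otimes T_l\in V^{\otimes m}$ for their tensor product with the factors of $T_i$ placed at the positions $J_i$. Put $P(n,k)=n(n+2)\cdots(n+2k-2)$. (i) If $|J_i|$ is odd for at least one $i$, then $\mathbb{E}(X)=0$.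 (ii) If $|J_i|=2k_i$ for $i=1,\dots,l$, let $\Pi(J_i)$ be the set of all pairings of $J_i$ and $\Pi=\Pi(J_1)\times\cdots\times\Pi(J_l)$. Then $|\Pi(J_i)|=(2k_i-1)!!$ for every $i$, and $$\mathbb{E}(X)=\left(\prod_{i=1}^{l}\frac{(2k_i-1)!!}{P(n,k_i)}\right)\frac{1}{|\Pi|}\sum_{(\mathcal{P}_1,\dots,\mathcal{P}_l)\in\Pi} I(\mathcal{P}_1)\otimes\cdots\otimes I(\mathcal{P}_l).$$ -/

import Mathlib

open MeasureTheory ProbabilityTheory Finset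
open scoped TensorProduct

noncomputable section

namespace VeroneseTensor

/-- `T` is the expectation of the random vector `X` with values in the real vector space `W`
(used for `W` of finite dimension): every linear coordinate of `X` is integrable and has
expectation equal to that coordinate of `T`. -/
def HasExpectation {Ω : Type*} [MeasurableSpace Ω] (μ : Measure Ω) {W : Type*} [AddCommGroup W]
    [Module ℝ W] (X : Ω → W) (T : W) : Prop :=
  ∀ φ : Module.Dual ℝ W, Integrable (fun ω => φ (X ω)) μ ∧ ∫ ω, φ (X ω) ∂μ = φ T

theorem HasExpectation.unique {Ω : Type*} [MeasurableSpace Ω] {μ : Measure Ω} {W : Type*}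
    [AddCommGroup W] [Module ℝ W] {X : Ω → W} {T T' : W}
    (h : HasExpectation μ X T) (h' : HasExpectation μ X T') : T = T' := by
  rw [← sub_eq_zero, ← Module.forall_dual_apply_eq_zero_iff ℝ]
  intro φ
  rw [map_sub, ← (h φ).2, ← (h' φ).2, sub_self]

/-- A random unit vector whose law is invariant under the full orthogonal group `O(V)`. -/
def IsInvariantRandomUnitVector {V : Type*} [NormedAddCommGroup V] [InnerProductSpace ℝ V]
    [MeasurableSpace V] {Ω : Type*} [MeasurableSpace Ω] (μ : Measure Ω)
    (x : Ω → Metric.sphere (0 : V) 1) : Prop :=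
  Measurable x ∧
    ∀ g : V ≃ₗᵢ[ℝ] V, μ.map (fun ω => g (x ω : V)) = μ.map (fun ω => (x ω : V))

/-- The block of the partition `P` that contains the index `j`. -/
def block {ι : Type*} [Fintype ι] [DecidableEq ι] (P : Finpartition (univ : Finset ι)) (j : ι) :
    {B // B ∈ P.parts} :=
  ⟨P.part j, P.part_mem.2 (mem_univ j)⟩

/-- The decomposable tensor `v₁(J₁) ⊗ ⋯ ⊗ v_l(J_l)`, which has the vector `v B` at all the
positions that belong to the block `B` of the partition `P`. -/
def blockTensor {V : Type*} [AddCommGroup V] [Module ℝ V] {ι : Type*} [Fintype ι] [DecidableEq ι]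
    (P : Finpartition (univ : Finset ι)) (v : {B // B ∈ P.parts} → V) : ⨂[ℝ] _ : ι, V :=
  PiTensorProduct.tprod ℝ fun j => v (block P j)

/-- The pairings on `ι`: the partitions of `ι` into two-element blocks. -/
abbrev Pairing (ι : Type*) [Fintype ι] [DecidableEq ι] : Type _ :=
  {Q : Finpartition (univ : Finset ι) // ∀ p ∈ Q.parts, #p = 2}

/-- The standard invariant `I(Q) = ∑_{i₁, …, i_k} e_{i₁}(Q₁) ⊗ ⋯ ⊗ e_{i_k}(Q_k)` of a pairing
`Q = {Q₁, …, Q_k}`. -/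
def pairingInvariant {V : Type*} [NormedAddCommGroup V] [InnerProductSpace ℝ V] {n : ℕ}
    (e : OrthonormalBasis (Fin n) ℝ V) {ι : Type*} [Fintype ι] [DecidableEq ι] (Q : Pairing ι) :
    ⨂[ℝ] _ : ι, V :=
  ∑ i : {p // p ∈ Q.1.parts} → Fin n, blockTensor Q.1 fun p => e (i p)

/-- The tensor `T₁ ⊗ ⋯ ⊗ T_l` on the index set `ι`, where `T B` is a tensor on the block `B` of
the partition `P`, and its factors are placed at the positions that belong to `B`. It is
the multilinear map that takes decomposable tensors `T B = ⨂_{j ∈ B} v j` to `⨂_j v j`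
(`placedProduct_tprod`), written out in the basis of the tensor space given by `e`. -/
def placedProduct {V : Type*} [NormedAddCommGroup V] [InnerProductSpace ℝ V] {n : ℕ}
    (e : OrthonormalBasis (Fin n) ℝ V) {ι : Type*} [Fintype ι] [DecidableEq ι]
    (P : Finpartition (univ : Finset ι)) :
    MultilinearMap ℝ (fun B : {B // B ∈ P.parts} => ⨂[ℝ] _ : {j // j ∈ B.1}, V)
      (⨂[ℝ] _ : ι, V) :=
  ∑ f : ι → Fin n,
    ((MultilinearMap.mkPiAlgebra ℝ {B // B ∈ P.parts} ℝ).compLinearMap fun B =>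
      (Basis.piTensorProduct fun _ : {j // j ∈ B.1} => e.toBasis).coord fun j => f j).smulRight
      (PiTensorProduct.tprod ℝ fun j => e (f j))

theorem placedProduct_tprod {V : Type*} [NormedAddCommGroup V] [InnerProductSpace ℝ V] {n : ℕ}
    (e : OrthonormalBasis (Fin n) ℝ V) {ι : Type*} [Fintype ι] [DecidableEq ι]
    (P : Finpartition (univ : Finset ι)) (v : ι → V) :
    placedProduct e P (fun B => PiTensorProduct.tprod ℝ fun j : {j // j ∈ B.1} => v j) =
      PiTensorProduct.tprod ℝ v := by
  have key : ∀ f : ι → Fin n,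
      (∏ B : {B // B ∈ P.parts}, ∏ j : {j // j ∈ B.1}, e.toBasis.repr (v j) (f j)) =
        ∏ j, e.toBasis.repr (v j) (f j) := by
    intro f
    have h1 : ∀ B : {B // B ∈ P.parts},
        (∏ j : {j // j ∈ B.1}, e.toBasis.repr (v j) (f j)) =
          ∏ j ∈ B.1, e.toBasis.repr (v j) (f j) :=
      fun B => prod_coe_sort B.1 fun j => e.toBasis.repr (v j) (f j)
    rw [prod_congr rfl fun B _ => h1 B,
      prod_coe_sort P.parts fun B => ∏ j ∈ B, e.toBasis.repr (v j) (f j),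
      ← prod_biUnion (t := fun B => B) P.supIndep.pairwiseDisjoint]
    exact congrArg (fun s : Finset ι => ∏ j ∈ s, e.toBasis.repr (v j) (f j)) P.biUnion_parts
  rw [← (Basis.piTensorProduct fun _ : ι => e.toBasis).sum_repr (PiTensorProduct.tprod ℝ v)]
  simp only [placedProduct, _root_.sum_apply, MultilinearMap.smulRight_apply,
    MultilinearMap.compLinearMap_apply, MultilinearMap.mkPiAlgebra_apply, Module.Basis.coord_apply,
    Basis.piTensorProduct_repr_tprod_apply, Basis.piTensorProduct_apply, key,
    OrthonormalBasis.coe_toBasis]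

/-- `P(n,k) = n (n + 2) ⋯ (n + 2k - 2)`. -/
def risingEvenProduct (n k : ℕ) : ℝ := ∏ j ∈ range k, ((n : ℝ) + 2 * j)

end VeroneseTensor

end

/-! A tensor is determined by its coordinates in the basis of products of the `e i`, so it suffices
to compare coordinates. By independence, each coordinate of the expectation is a product over the
blocks of mixed moments of a single uniform unit vector `y`. Invariance under `-1` kills the moments
of odd degree.

For the even moments, differentiate the invariance along rotations of the plane of coordinates `f a`
and `i`, applied to the monomial in which the index at `a` is replaced by `i`. Summing over `i` and
using `∑ y_i ^ 2 = 1` gives the recursion (`moment_recursion`) `(n + #J - 2) E ∏_J y_{f j} = ∑_b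
δ_{f a, f b} E ∏_{J \ {a, b}} y_{f j}`. The sum over pairings of `J` of products of Kronecker deltas
expands in the same way along the partner `b` of `a` (`pairingSum_eq_sum_erase`). Hence `P(n,k)`
times the moment is that sum (`moment_eq_pairingSum`), which is also the coordinate of the sum of
the `I(𝒫)`. Reflections in lines are the only isometries needed for the recursion. -/

namespace VeroneseTensor

/-! ### Pairings of subsets and their enumeration -/

/-- `𝒬` is a partition of `J` into two-element sets. -/
def IsPairing {ι : Type*} (J : Finset ι) (𝒬 : Finset (Finset ι)) : Prop :=
  (∀ p ∈ 𝒬, #p = 2) ∧ (∀ p ∈ 𝒬, ∀ q ∈ 𝒬, ∀ j ∈ p, j ∈ q → p = q) ∧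
    ∀ j, j ∈ J ↔ ∃ p ∈ 𝒬, j ∈ p

open Classical in
/-- The finite set of pairings of `J`. -/
noncomputable def pairings {ι : Type*} [Fintype ι] (J : Finset ι) : Finset (Finset (Finset ι)) :=
  {𝒬 | IsPairing J 𝒬}

theorem mem_pairings {ι : Type*} [Fintype ι] {J : Finset ι} {𝒬 : Finset (Finset ι)} :
    𝒬 ∈ pairings J ↔ IsPairing J 𝒬 := by
  simp [pairings]

theorem pairings_empty {ι : Type*} [Fintype ι] : pairings (∅ : Finset ι) = {∅} := by
  ext 𝒬
  rw [mem_pairings, mem_singleton]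
  constructor
  · rintro ⟨h1, -, h3⟩
    rw [eq_empty_iff_forall_notMem]
    intro p hp
    obtain ⟨j, hj⟩ : p.Nonempty := by
      rw [← card_pos, h1 p hp]; norm_num
    exact absurd ((h3 j).2 ⟨p, hp, hj⟩) (notMem_empty j)
  · rintro rfl
    simp [IsPairing]

theorem IsPairing.erase_pair {ι : Type*} [DecidableEq ι] {J : Finset ι} {𝒬 : Finset (Finset ι)}
    (h : IsPairing J 𝒬) {a b : ι} (hab : {a, b} ∈ 𝒬) :
    IsPairing ((J.erase a).erase b) (𝒬.erase {a, b}) := by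
  obtain ⟨h1, h2, h3⟩ := h
  refine ⟨fun p hp => h1 p (mem_of_mem_erase hp),
    fun p hp q hq => h2 p (mem_of_mem_erase hp) q (mem_of_mem_erase hq), fun j => ?_⟩
  simp only [mem_erase, h3]
  constructor
  · rintro ⟨hb, ha, p, hp, hj⟩
    refine ⟨p, ⟨?_, hp⟩, hj⟩
    rintro rfl
    simp_all
  · rintro ⟨p, ⟨hne, hp⟩, hj⟩
    refine ⟨?_, ?_, p, hp, hj⟩
    · rintro rfl
      exact hne (h2 p hp _ hab j hj (by simp))
    · rintro rfl
      exact hne (h2 p hp _ hab j hj (by simp))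

theorem IsPairing.insert_pair {ι : Type*} [DecidableEq ι] {J : Finset ι} {𝒬 : Finset (Finset ι)}
    {a b : ι} (h : IsPairing ((J.erase a).erase b) 𝒬) (ha : a ∈ J) (hb : b ∈ J.erase a) :
    IsPairing J (insert {a, b} 𝒬) ∧ {a, b} ∉ 𝒬 := by
  obtain ⟨h1, h2, h3⟩ := h
  obtain ⟨hba, hb⟩ := mem_erase.1 hb
  have ha' : ∀ p ∈ 𝒬, a ∉ p := fun p hp hap => by
    have := (h3 a).2 ⟨p, hp, hap⟩
    simp at this
  have hb' : ∀ p ∈ 𝒬, b ∉ p := fun p hp hap => by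
    have := (h3 b).2 ⟨p, hp, hap⟩
    simp at this
  refine ⟨⟨?_, ?_, ?_⟩, fun hc => ha' _ hc (by simp)⟩
  · intro p hp
    rcases mem_insert.1 hp with rfl | hp
    · exact card_pair hba.symm
    · exact h1 p hp
  · intro p hp q hq j hjp hjq
    have hpair : ∀ r ∈ 𝒬, j ∈ r → j ∉ ({a, b} : Finset ι) := by
      intro r hr hjr hj
      rcases mem_insert.1 hj with rfl | hj
      · exact ha' r hr hjr
      · rw [mem_singleton.1 hj] at hjr
        exact hb' r hr hjr
    rcases mem_insert.1 hp with rfl | hp' <;> rcases mem_insert.1 hq with rfl | hq'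
    · rfl
    · exact absurd hjp (hpair q hq' hjq)
    · exact absurd hjq (hpair p hp' hjp)
    · exact h2 p hp' q hq' j hjp hjq
  · intro j
    have := h3 j
    simp only [mem_erase] at this
    simp only [mem_insert, exists_eq_or_imp, ← this, mem_singleton]
    by_cases hja : j = a
    · simp [hja, ha]
    · by_cases hjb : j = b
      · simp [hjb, hb]
      · simp [hja, hjb]

/-- The sum over all pairings of `J` of the product of the weights of the pairs. -/
noncomputable def pairingSum {ι R : Type*} [Fintype ι] [CommSemiring R] (W : Finset ι → R)
    (J : Finset ι) : R :=
  ∑ 𝒬 ∈ pairings J, ∏ p ∈ 𝒬, W p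

theorem pairingSum_empty {ι R : Type*} [Fintype ι] [CommSemiring R] (W : Finset ι → R) :
    pairingSum W ∅ = 1 := by
  simp [pairingSum, pairings_empty]

/-- Expansion of the sum over pairings along the partner of a fixed element. -/
theorem pairingSum_eq_sum_erase {ι R : Type*} [Fintype ι] [DecidableEq ι] [CommSemiring R]
    (W : Finset ι → R) {J : Finset ι} {a : ι} (ha : a ∈ J) :
    pairingSum W J =
      ∑ b ∈ J.erase a, W {a, b} * pairingSum W ((J.erase a).erase b) := by
  simp only [pairingSum, mul_sum]
  rw [sum_sigma']
  symm
  refine sum_bij (fun s _ => insert {a, s.1} s.2) ?_ ?_ ?_ ?_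
  · rintro ⟨b, 𝒬⟩ hs
    obtain ⟨hb, h𝒬⟩ := mem_sigma.1 hs
    exact mem_pairings.2 ((mem_pairings.1 h𝒬).insert_pair ha hb).1
  · rintro ⟨b, 𝒬⟩ hs ⟨b', 𝒬'⟩ hs' heq
    obtain ⟨hb, h𝒬⟩ := mem_sigma.1 hs
    obtain ⟨hb', h𝒬'⟩ := mem_sigma.1 hs'
    have h1 := (mem_pairings.1 h𝒬).insert_pair ha hb
    have h2 := (mem_pairings.1 h𝒬').insert_pair ha hb'
    simp only at h1 h2 heq hb hb'
    -- The partner of `a` can be recovered from the pairing, since only one of its pairs contains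
    -- `a`.
    have hpair : ({a, b} : Finset ι) = {a, b'} := by
      refine h1.1.2.1 _ (mem_insert_self _ _) _ ?_ a (by simp) (by simp)
      rw [heq]
      exact mem_insert_self _ _
    have hbb : b = b' := by
      have : b ∈ ({a, b'} : Finset ι) := hpair ▸ (by simp)
      rcases mem_insert.1 this with h | h
      · exact absurd h (mem_erase.1 hb).1
      · exact mem_singleton.1 h
    subst hbb
    have : 𝒬 = 𝒬' := by
      rw [← erase_insert h1.2, heq, erase_insert h2.2]
    rw [this]
  · intro 𝒬 h𝒬
    have h := mem_pairings.1 h𝒬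
    obtain ⟨p, hp, hap⟩ := (h.2.2 a).1 ha
    obtain ⟨b, hb⟩ : ∃ b, p.erase a = {b} := by
      rw [← card_eq_one, card_erase_of_mem hap, h.1 p hp]
    have hpab : p = {a, b} := by rw [← insert_erase hap, hb]
    have hbp : b ∈ p.erase a := hb ▸ mem_singleton_self b
    subst hpab
    refine ⟨⟨b, 𝒬.erase {a, b}⟩, mem_sigma.2 ⟨?_, mem_pairings.2 (h.erase_pair hp)⟩,
      insert_erase hp⟩
    exact mem_erase.2 ⟨(mem_erase.1 hbp).1, (h.2.2 b).2 ⟨_, hp, (mem_erase.1 hbp).2⟩⟩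
  · rintro ⟨b, 𝒬⟩ hs
    obtain ⟨hb, h𝒬⟩ := mem_sigma.1 hs
    exact (prod_insert ((mem_pairings.1 h𝒬).insert_pair ha hb).2).symm

theorem card_pairings {ι : Type*} [Fintype ι] [DecidableEq ι] (k : ℕ) :
    ∀ J : Finset ι, #J = 2 * k → #(pairings J) = Nat.doubleFactorial (2 * k - 1) := by
  induction k with
  | zero =>
    intro J hJ
    rw [card_eq_zero.1 hJ, pairings_empty]
    simp
  | succ k ih =>
    intro J hJ
    obtain ⟨a, ha⟩ : J.Nonempty := card_pos.1 (by omega)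
    -- With all weights equal to 1 the sum over pairings counts them.
    have h := pairingSum_eq_sum_erase (R := ℕ) (fun _ => 1) ha
    simp only [pairingSum, prod_const_one, ← card_eq_sum_ones, one_mul] at h
    have hc : #(J.erase a) = 2 * k + 1 := by
      rw [card_erase_of_mem ha]; omega
    rw [h, sum_congr rfl fun b hb => ih _ (by rw [card_erase_of_mem hb]; omega), sum_const, hc,
      smul_eq_mul]
    -- The case `k = 0` is separate because `2 * 0 - 1` is truncated to 0, where the double
    -- factorial is still 1.
    rcases k with _ | k
    · simp
    · rw [show 2 * (k + 1 + 1) - 1 = (2 * (k + 1) - 1) + 2 by omega,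
        Nat.doubleFactorial_add_two]
      congr 1

theorem isPairing_parts {ι : Type*} [Fintype ι] [DecidableEq ι] (Q : Pairing ι) :
    IsPairing univ Q.1.parts := by
  refine ⟨Q.2, fun p hp q hq j hj hj' => Q.1.eq_of_mem_parts hp hq hj hj', fun j => ?_⟩
  simpa using ⟨_, Q.1.part_mem.2 (mem_univ j), Q.1.mem_part (mem_univ j)⟩

theorem IsPairing.exists_pairing {ι : Type*} [Fintype ι] [DecidableEq ι] {𝒬 : Finset (Finset ι)}
    (h : IsPairing univ 𝒬) : ∃ Q : Pairing ι, Q.1.parts = 𝒬 := by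
  refine ⟨⟨Finpartition.ofExistsUnique 𝒬 (fun p _ => subset_univ p) ?_ ?_, h.1⟩, rfl⟩
  · intro j _
    obtain ⟨p, hp, hj⟩ := (h.2.2 j).1 (mem_univ j)
    exact ⟨p, ⟨hp, hj⟩, fun q hq => h.2.1 q hq.1 p hp j hq.2 hj⟩
  · intro h0
    simpa using h.1 _ h0

/-- Passes from partitions of a whole type to families of pairs inside a fixed type. The latter
allow induction on the subset `J`. -/
theorem sum_pairing_eq {ι M : Type*} [Fintype ι] [DecidableEq ι] [AddCommMonoid M]
    (F : Finset (Finset ι) → M) :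
    ∑ Q : Pairing ι, F Q.1.parts = ∑ 𝒬 ∈ pairings (univ : Finset ι), F 𝒬 := by
  refine sum_bij (fun Q _ => Q.1.parts) (fun Q _ => mem_pairings.2 (isPairing_parts Q))
    (fun Q _ Q' _ h => Subtype.ext (Finpartition.ext h)) ?_ fun _ _ => rfl
  intro 𝒬 h𝒬
  obtain ⟨Q, hQ⟩ := (mem_pairings.1 h𝒬).exists_pairing
  exact ⟨Q, mem_univ _, hQ⟩

theorem card_pairing {ι : Type*} [Fintype ι] [DecidableEq ι] {k : ℕ}
    (h : Fintype.card ι = 2 * k) :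
    Fintype.card (Pairing ι) = Nat.doubleFactorial (2 * k - 1) := by
  rw [← card_pairings k (univ : Finset ι) h, card_eq_sum_ones, ← sum_pairing_eq fun _ => 1]
  simp

/-! ### Moments of a random unit vector in coordinates -/

/-- The reflection of `ℝⁿ` in the line spanned by the unit vector `w`. -/
def lineReflection {n : ℕ} (w y : Fin n → ℝ) : Fin n → ℝ :=
  fun l => 2 * (∑ r, w r * y r) * w l - y l

theorem continuous_lineReflection {n : ℕ} (w : Fin n → ℝ) : Continuous (lineReflection w) := by
  unfold lineReflection
  fun_prop

/-- The law of the random vector `y` lies on the unit sphere of `ℝⁿ` and is invariant under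
reflections in lines. -/
structure IsReflectionInvariant {Ω : Type*} [MeasurableSpace Ω] (μ : Measure Ω) {n : ℕ}
    (y : Ω → Fin n → ℝ) : Prop where
  measurable : Measurable y
  sum_sq : ∀ ω, ∑ l, y ω l ^ 2 = 1
  integral_comp : ∀ w : Fin n → ℝ, ∑ l, w l ^ 2 = 1 → ∀ F : (Fin n → ℝ) → ℝ, Continuous F →
    ∫ ω, F (lineReflection w (y ω)) ∂μ = ∫ ω, F (y ω) ∂μ

namespace IsReflectionInvariant

variable {Ω : Type*} [MeasurableSpace Ω] {μ : Measure Ω} {n : ℕ} {y : Ω → Fin n → ℝ}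

theorem abs_le_one (hy : IsReflectionInvariant μ y) (ω : Ω) (l : Fin n) : |y ω l| ≤ 1 := by
  rw [← sq_le_one_iff_abs_le_one, ← hy.sum_sq ω]
  exact single_le_sum (f := fun l => y ω l ^ 2) (fun _ _ => sq_nonneg _) (mem_univ l)

theorem integrable_comp [IsFiniteMeasure μ] (hy : IsReflectionInvariant μ y)
    {F : (Fin n → ℝ) → ℝ} (hF : Continuous F) : Integrable (fun ω => F (y ω)) μ := by
  have hc : IsCompact (Metric.closedBall (0 : Fin n → ℝ) 1) := isCompact_closedBall _ _
  obtain ⟨C, hC⟩ := hc.exists_bound_of_continuousOn hF.continuousOn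
  refine Integrable.of_bound (hF.measurable.comp hy.measurable).aestronglyMeasurable C
    (ae_of_all _ fun ω => hC _ ?_)
  rw [mem_closedBall_zero_iff, pi_norm_le_iff_of_nonneg zero_le_one]
  exact hy.abs_le_one ω

/-- The infinitesimal form of invariance, for the rotations of a coordinate plane. -/
theorem sum_integral_rotation [IsFiniteMeasure μ] (hy : IsReflectionInvariant μ y)
    {ι : Type*} [DecidableEq ι] (K : Finset ι) (f : ι → Fin n) (c i : Fin n) :
    ∫ ω, ∑ j ∈ K, ((if f j = i then 1 else 0) * y ω c - (if f j = c then 1 else 0) * y ω i) *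
      ∏ l ∈ K.erase j, y ω (f l) ∂μ = 0 := by
  -- For `c = i` the integrand vanishes. Otherwise `e_c` and `e_i` are orthogonal, so the vectors `w
  -- t` below have norm one.
  rcases eq_or_ne c i with rfl | hci
  · simp
  -- The line spanned by `w t` turns in the `(c, i)`-plane. The reflection `z t` in it is a curve of
  -- isometries whose velocity `z'` at 0 is, after the reflection `z 0`, twice the rotation
  -- generator.
  let w : ℝ → Fin n → ℝ := fun t l =>
    Real.cos t * (if l = c then 1 else 0) + Real.sin t * (if l = i then 1 else 0)
  let w' : ℝ → Fin n → ℝ := fun t l =>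
    -Real.sin t * (if l = c then 1 else 0) + Real.cos t * (if l = i then 1 else 0)
  let z : ℝ → Ω → Fin n → ℝ := fun t ω l =>
    2 * (Real.cos t * y ω c + Real.sin t * y ω i) * w t l - y ω l
  let z' : ℝ → Ω → Fin n → ℝ := fun t ω l =>
    2 * ((-Real.sin t * y ω c + Real.cos t * y ω i) * w t l +
      (Real.cos t * y ω c + Real.sin t * y ω i) * w' t l)
  have hz : ∀ t ω, z t ω = lineReflection (w t) (y ω) := by
    intro t ω
    funext l
    simp only [z, lineReflection, w, add_mul, sum_add_distrib]
    simp [mul_assoc]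
  have hw : ∀ t, ∑ l, w t l ^ 2 = 1 := by
    intro t
    have : ∀ l, w t l ^ 2 = Real.cos t ^ 2 * (if l = c then 1 else 0) +
        Real.sin t ^ 2 * (if l = i then 1 else 0) := by
      intro l
      simp only [w]
      by_cases h1 : l = c
      · simp [h1, hci]
      · by_cases h2 : l = i <;> simp [h1, h2, hci.symm]
    simp [this, sum_add_distrib]
  have hconst : ∀ t, ∫ ω, ∏ j ∈ K, z t ω (f j) ∂μ = ∫ ω, ∏ j ∈ K, y ω (f j) ∂μ := by
    intro t
    simp only [hz]
    exact hy.integral_comp (w t) (hw t) (fun v => ∏ j ∈ K, v (f j)) (by fun_prop)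
  have hwb : ∀ t l, |w t l| ≤ 2 := by
    intro t l
    have h1 := Real.abs_cos_le_one t
    have h2 := Real.abs_sin_le_one t
    rw [abs_le] at *
    simp only [w]
    split_ifs <;> constructor <;> linarith
  have hwb' : ∀ t l, |w' t l| ≤ 2 := by
    intro t l
    have h1 := Real.abs_cos_le_one t
    have h2 := Real.abs_sin_le_one t
    rw [abs_le] at *
    simp only [w']
    split_ifs <;> constructor <;> linarith
  have hlin : ∀ s t ω, |s| ≤ 1 → |t| ≤ 1 → |s * y ω c + t * y ω i| ≤ 2 := by
    intro s t ω hs ht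
    calc |s * y ω c + t * y ω i| ≤ |s| * |y ω c| + |t| * |y ω i| := by
          rw [← abs_mul, ← abs_mul]; exact abs_add_le _ _
      _ ≤ 1 * 1 + 1 * 1 := by
          gcongr
          exacts [hy.abs_le_one ω c, hy.abs_le_one ω i]
      _ = 2 := by norm_num
  have hzb : ∀ t ω l, |z t ω l| ≤ 9 := by
    intro t ω l
    calc |z t ω l| ≤ |2 * (Real.cos t * y ω c + Real.sin t * y ω i) * w t l| + |y ω l| :=
          abs_sub _ _
      _ ≤ 2 * 2 * 2 + 1 := by
          rw [abs_mul, abs_mul, abs_two]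
          gcongr
          exacts [hlin _ _ ω (Real.abs_cos_le_one t) (Real.abs_sin_le_one t), hwb t l,
            hy.abs_le_one ω l]
      _ = 9 := by norm_num
  have hzb' : ∀ t ω l, |z' t ω l| ≤ 16 := by
    intro t ω l
    calc |z' t ω l| ≤ 2 * (|(-Real.sin t * y ω c + Real.cos t * y ω i)| * |w t l| +
          |(Real.cos t * y ω c + Real.sin t * y ω i)| * |w' t l|) := by
          simp only [z', abs_mul, abs_two]
          gcongr
          rw [← abs_mul, ← abs_mul]
          exact abs_add_le _ _
      _ ≤ 2 * (2 * 2 + 2 * 2) := by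
          gcongr
          exacts [hlin _ _ ω (by rw [abs_neg]; exact Real.abs_sin_le_one t)
            (Real.abs_cos_le_one t), hwb t l,
            hlin _ _ ω (Real.abs_cos_le_one t) (Real.abs_sin_le_one t), hwb' t l]
      _ = 16 := by norm_num
  have hdz : ∀ t ω l, HasDerivAt (fun t => z t ω l) (z' t ω l) t := by
    intro t ω l
    have h1 : HasDerivAt (fun t => Real.cos t * y ω c + Real.sin t * y ω i)
        (-Real.sin t * y ω c + Real.cos t * y ω i) t :=
      ((Real.hasDerivAt_cos t).mul_const _).add ((Real.hasDerivAt_sin t).mul_const _)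
    have h2 : HasDerivAt (fun t => w t l) (w' t l) t :=
      ((Real.hasDerivAt_cos t).mul_const _).add ((Real.hasDerivAt_sin t).mul_const _)
    refine (((h1.const_mul 2).mul h2).sub_const (y ω l)).congr_deriv ?_
    simp only [z']
    ring
  have hym : ∀ l, Measurable fun ω => y ω l := fun l => (measurable_pi_apply l).comp hy.measurable
  have hzm : ∀ t l, Measurable fun ω => z t ω l := by
    intro t l
    simp only [z]
    have := hym c
    have := hym i
    have := hym l
    fun_prop
  have hzm' : ∀ t l, Measurable fun ω => z' t ω l := by
    intro t l
    simp only [z']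
    have := hym c
    have := hym i
    fun_prop
  -- Differentiation under the integral sign, dominated by a constant since `z` and `z'` are
  -- uniformly bounded.
  have key := hasDerivAt_integral_of_dominated_loc_of_deriv_le (μ := μ) (s := Set.univ)
    (x₀ := (0 : ℝ)) (F := fun t ω => ∏ j ∈ K, z t ω (f j))
    (F' := fun t ω => ∑ j ∈ K, (∏ l ∈ K.erase j, z t ω (f l)) • z' t ω (f j))
    (bound := fun _ => ∑ j ∈ K, (∏ l ∈ K.erase j, (9 : ℝ)) * 16) Filter.univ_mem
    (Filter.Eventually.of_forall fun t =>
      (Finset.measurable_fun_prod K fun j _ => hzm t (f j)).aestronglyMeasurable)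
    ?_ (Finset.measurable_fun_sum K fun j _ =>
      ((Finset.measurable_fun_prod _ fun l _ => hzm 0 (f l)).mul
        (hzm' 0 (f j)))).aestronglyMeasurable
    (ae_of_all _ fun ω t _ => ?_) (integrable_const _)
    (ae_of_all _ fun ω t _ => HasDerivAt.fun_finsetProd fun j _ => hdz t ω (f j))
  rotate_left
  · simp only [hz]
    exact hy.integrable_comp (F := fun v => ∏ j ∈ K, lineReflection (w 0) v (f j))
      (continuous_finsetProd _ fun j _ =>
        (continuous_apply (f j)).comp (continuous_lineReflection _))
  · refine (norm_sum_le _ _).trans (sum_le_sum fun j _ => ?_)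
    rw [smul_eq_mul, norm_mul, norm_prod]
    gcongr with l
    exacts [hzb t ω _, hzb' t ω _]
  have hzero : ∫ ω, ∑ j ∈ K, (∏ l ∈ K.erase j, z 0 ω (f l)) • z' 0 ω (f j) ∂μ = 0 := by
    refine key.2.unique ?_
    simp only [hconst]
    exact hasDerivAt_const _ _
  -- Invariance once more, now to replace `y` by `z 0` in the claimed integral.
  have hmove := hy.integral_comp (w 0) (hw 0) (fun v => ∑ j ∈ K,
    ((if f j = i then 1 else 0) * v c - (if f j = c then 1 else 0) * v i) *
      ∏ l ∈ K.erase j, v (f l)) (by fun_prop)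
  have hhalf : ∫ ω, 1 / 2 * ∑ j ∈ K, (∏ l ∈ K.erase j, z 0 ω (f l)) • z' 0 ω (f j) ∂μ = 0 := by
    rw [integral_const_mul, hzero, mul_zero]
  rw [← hmove]
  refine Eq.trans ?_ hhalf
  refine integral_congr_ae (ae_of_all _ fun ω => ?_)
  simp only [← hz]
  rw [mul_sum]
  refine sum_congr rfl fun j _ => ?_
  -- The reflection at time 0 fixes coordinate `c` and negates coordinate `i`.
  have h1 : z 0 ω c = y ω c := by simp [z, w, hci]; ring
  have h2 : z 0 ω i = - y ω i := by simp [z, w, hci.symm]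
  rw [h1, h2]
  simp [z', w, w']
  ring

/-- The term `j = a` contributes `n - 1` copies of the monomial. Each of the `#J - 1` terms `j = b ≠
a` contributes one copy, minus a delta term in which `∑ y_i ^ 2 = 1` has removed the two factors at
`a` and `b`. -/
theorem sum_rotation_eq (hy : IsReflectionInvariant μ y) (ω : Ω)
    {ι : Type*} [DecidableEq ι] {J : Finset ι} {a : ι} (ha : a ∈ J) (f : ι → Fin n) :
    ∑ i, ∑ j ∈ J, ((if Function.update f a i j = i then 1 else 0) * y ω (f a) -
        (if Function.update f a i j = f a then 1 else 0) * y ω i) *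
        ∏ l ∈ J.erase j, y ω (Function.update f a i l) =
      ((n : ℝ) + #J - 2) * ∏ j ∈ J, y ω (f j) -
        ∑ b ∈ J.erase a, (if f a = f b then 1 else 0) *
          ∏ j ∈ (J.erase a).erase b, y ω (f j) := by
  have hprod : ∀ (i : Fin n) (s : Finset ι), a ∉ s →
      ∏ l ∈ s, y ω (Function.update f a i l) = ∏ l ∈ s, y ω (f l) := by
    intro i s hs
    refine prod_congr rfl fun l hl => ?_
    rw [Function.update_of_ne (ne_of_mem_of_not_mem hl hs)]
  have hq : ∏ j ∈ J, y ω (f j) = y ω (f a) * ∏ j ∈ J.erase a, y ω (f j) :=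
    (mul_prod_erase J _ ha).symm
  have hterm : ∀ b ∈ J.erase a,
      ∑ i, ((if Function.update f a i b = i then 1 else 0) * y ω (f a) -
        (if Function.update f a i b = f a then 1 else 0) * y ω i) *
        ∏ l ∈ J.erase b, y ω (Function.update f a i l) =
      ∏ j ∈ J, y ω (f j) - (if f a = f b then 1 else 0) *
          ∏ j ∈ (J.erase a).erase b, y ω (f j) := by
    intro b hb
    have hba := (mem_erase.1 hb).1
    have hr : ∀ i, ∏ l ∈ J.erase b, y ω (Function.update f a i l) =
        y ω i * ∏ j ∈ (J.erase a).erase b, y ω (f j) := by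
      intro i
      rw [← mul_prod_erase (J.erase b) _ (mem_erase.2 ⟨hba.symm, ha⟩), Function.update_self,
        erase_right_comm, hprod i _ (by simp)]
    have hqb : ∏ j ∈ J.erase a, y ω (f j) =
        y ω (f b) * ∏ j ∈ (J.erase a).erase b, y ω (f j) := (mul_prod_erase _ _ hb).symm
    simp only [hr, Function.update_of_ne hba]
    rw [hq, hqb]
    set r := ∏ j ∈ (J.erase a).erase b, y ω (f j)
    have : ∀ i, ((if f b = i then 1 else 0) * y ω (f a) -
        (if f b = f a then 1 else 0) * y ω i) * (y ω i * r) =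
        (if f b = i then 1 else 0) * (y ω (f a) * (y ω i * r)) -
          (if f a = f b then 1 else 0) * r * y ω i ^ 2 := by
      intro i
      simp only [eq_comm (a := f b) (b := f a)]
      ring
    simp only [this, sum_sub_distrib, ← mul_sum, hy.sum_sq ω]
    simp
  have hself : ∑ i, ((if Function.update f a i a = i then 1 else 0) * y ω (f a) -
        (if Function.update f a i a = f a then 1 else 0) * y ω i) *
        ∏ l ∈ J.erase a, y ω (Function.update f a i l) =
      ((n : ℝ) - 1) * ∏ j ∈ J, y ω (f j) := by
    simp only [hprod _ _ (notMem_erase a J), Function.update_self, ← sum_mul, sum_sub_distrib, hq]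
    simp
    ring
  have hcard : (#(J.erase a) : ℝ) = #J - 1 := by
    rw [← card_erase_add_one ha]
    push_cast
    ring
  rw [sum_comm, ← add_sum_erase J _ ha, hself, sum_congr rfl hterm, sum_sub_distrib, sum_const,
    nsmul_eq_mul, hcard]
  ring

theorem integrable_prod [IsFiniteMeasure μ] (hy : IsReflectionInvariant μ y)
    {ι : Type*} (J : Finset ι) (f : ι → Fin n) : Integrable (fun ω => ∏ j ∈ J, y ω (f j)) μ :=
  hy.integrable_comp (F := fun v => ∏ j ∈ J, v (f j)) (by fun_prop)

/-- The recursion for the moments of the uniform distribution on the sphere. -/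
theorem moment_recursion [IsFiniteMeasure μ] (hy : IsReflectionInvariant μ y)
    {ι : Type*} [DecidableEq ι] {J : Finset ι} {a : ι} (ha : a ∈ J) (f : ι → Fin n) :
    ((n : ℝ) + #J - 2) * ∫ ω, ∏ j ∈ J, y ω (f j) ∂μ =
      ∑ b ∈ J.erase a, (if f a = f b then 1 else 0) *
        ∫ ω, ∏ j ∈ (J.erase a).erase b, y ω (f j) ∂μ := by
  have h : ∫ ω, ∑ i, ∑ j ∈ J, ((if Function.update f a i j = i then 1 else 0) * y ω (f a) -
        (if Function.update f a i j = f a then 1 else 0) * y ω i) *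
        ∏ l ∈ J.erase j, y ω (Function.update f a i l) ∂μ = 0 := by
    rw [integral_finsetSum]
    · exact sum_eq_zero fun i _ => hy.sum_integral_rotation J (Function.update f a i) (f a) i
    · intro i _
      exact hy.integrable_comp (F := fun v => ∑ j ∈ J,
        ((if Function.update f a i j = i then 1 else 0) * v (f a) -
        (if Function.update f a i j = f a then 1 else 0) * v i) *
        ∏ l ∈ J.erase j, v (Function.update f a i l)) (by fun_prop)
  simp only [hy.sum_rotation_eq _ ha f] at h
  rw [integral_sub ((hy.integrable_prod J f).const_mul _)
    (integrable_finsetSum _ fun b _ => (hy.integrable_prod _ f).const_mul _),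
    integral_const_mul, integral_finsetSum _ fun b _ => (hy.integrable_prod _ f).const_mul _,
    sub_eq_zero] at h
  simpa only [integral_const_mul] using h

/-- Both sides satisfy the same recursion in `J`. The weight of a pair `{a, b}` is the Kronecker
delta of `f a` and `f b`. -/
theorem moment_eq_pairingSum [IsProbabilityMeasure μ] (hy : IsReflectionInvariant μ y)
    {ι : Type*} [Fintype ι] [DecidableEq ι] (f : ι → Fin n) (k : ℕ) :
    ∀ J : Finset ι, #J = 2 * k →
      risingEvenProduct n k * ∫ ω, ∏ j ∈ J, y ω (f j) ∂μ =
        pairingSum (fun p => ∑ r : Fin n, ∏ j ∈ p, if f j = r then (1 : ℝ) else 0) J := by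
  induction k with
  | zero =>
    intro J hJ
    rw [card_eq_zero.1 hJ, pairingSum_empty]
    simp [risingEvenProduct]
  | succ k ih =>
    intro J hJ
    obtain ⟨a, ha⟩ : J.Nonempty := card_pos.1 (by omega)
    have hrec := hy.moment_recursion ha f
    -- Since `#J = 2 (k + 1)`, the coefficient in the recursion is the last factor of `P(n, k + 1)`.
    have hn : (n : ℝ) + #J - 2 = n + 2 * k := by
      rw [hJ]
      push_cast
      ring
    rw [hn] at hrec
    rw [risingEvenProduct, prod_range_succ, mul_assoc, hrec, pairingSum_eq_sum_erase _ ha, mul_sum]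
    refine sum_congr rfl fun b hb => ?_
    have hc : #((J.erase a).erase b) = 2 * k := by
      rw [card_erase_of_mem hb, card_erase_of_mem ha]
      omega
    have hw : ∑ r : Fin n, ∏ j ∈ ({a, b} : Finset ι), (if f j = r then (1 : ℝ) else 0) =
        if f a = f b then 1 else 0 := by
      simp only [prod_pair (mem_erase.1 hb).1.symm]
      simp [eq_comm]
    rw [hw, ← ih _ hc, risingEvenProduct]
    ring

end IsReflectionInvariant

theorem integral_prod_eq_zero_of_odd {Ω : Type*} [MeasurableSpace Ω] {μ : Measure Ω} {n : ℕ}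
    {y : Ω → Fin n → ℝ} (hy : ∀ F : (Fin n → ℝ) → ℝ, Continuous F →
      ∫ ω, F (-y ω) ∂μ = ∫ ω, F (y ω) ∂μ)
    {ι : Type*} {J : Finset ι} (hJ : Odd #J) (f : ι → Fin n) :
    ∫ ω, ∏ j ∈ J, y ω (f j) ∂μ = 0 := by
  have h := hy (fun v => ∏ j ∈ J, v (f j)) (by fun_prop)
  simp only [Pi.neg_apply, prod_neg, hJ.neg_one_pow, integral_const_mul] at h
  linarith

/-! ### Coordinates of block tensors, placed products and pairing invariants -/

theorem prod_parts_eq {ι M : Type*} [Fintype ι] [DecidableEq ι] [CommMonoid M]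
    (P : Finpartition (univ : Finset ι)) (F : {B // B ∈ P.parts} → ι → M) :
    ∏ j, F (block P j) j = ∏ B : {B // B ∈ P.parts}, ∏ j ∈ B.1, F B j := by
  rw [← prod_fiberwise_of_maps_to (s := univ) (t := univ) (g := block P) fun _ _ => mem_univ _]
  refine prod_congr rfl fun B _ => ?_
  have hB : (univ.filter fun j => block P j = B) = B.1 := by
    ext j
    simp only [mem_filter, mem_univ, true_and, block, Subtype.ext_iff]
    constructor
    · intro h
      rw [← h]
      exact P.mem_part (mem_univ j)
    · exact fun h => P.part_eq_of_mem B.2 h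
  rw [hB]
  refine prod_congr rfl fun j hj => ?_
  rw [← hB, mem_filter] at hj
  rw [hj.2]

section Coordinates

variable {V : Type*} [NormedAddCommGroup V] [InnerProductSpace ℝ V] {n : ℕ}
  (e : OrthonormalBasis (Fin n) ℝ V)

/-- The coordinates of a tensor in the basis given by `e`. -/
noncomputable def tensorCoord {ι : Type*} [Fintype ι] (f : ι → Fin n) :
    Module.Dual ℝ (⨂[ℝ] _ : ι, V) :=
  (Basis.piTensorProduct fun _ : ι => e.toBasis).coord f

theorem tensorCoord_tprod {ι : Type*} [Fintype ι] (f : ι → Fin n) (v : ι → V) :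
    tensorCoord e f (PiTensorProduct.tprod ℝ v) = ∏ j, e.repr (v j) (f j) := by
  simp [tensorCoord, Basis.piTensorProduct_repr_tprod_apply]

theorem sum_tensorCoord_smul {ι : Type*} [Fintype ι] [DecidableEq ι] (T : ⨂[ℝ] _ : ι, V) :
    ∑ f : ι → Fin n, tensorCoord e f T • PiTensorProduct.tprod ℝ (fun j => e (f j)) = T := by
  have h := (Basis.piTensorProduct fun _ : ι => e.toBasis).sum_repr T
  simpa only [Basis.piTensorProduct_apply, OrthonormalBasis.coe_toBasis, tensorCoord,
    Module.Basis.coord_apply] using h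

theorem tensorCoord_blockTensor {ι : Type*} [Fintype ι] [DecidableEq ι]
    (P : Finpartition (univ : Finset ι)) (v : {B // B ∈ P.parts} → V) (f : ι → Fin n) :
    tensorCoord e f (blockTensor P v) =
      ∏ B : {B // B ∈ P.parts}, ∏ j : {j // j ∈ B.1}, e.repr (v B) (f j) := by
  rw [blockTensor, tensorCoord_tprod, prod_parts_eq P fun B j => e.repr (v B) (f j)]
  exact prod_congr rfl fun B _ => (prod_coe_sort B.1 fun j => e.repr (v B) (f j)).symm

theorem tensorCoord_placedProduct {ι : Type*} [Fintype ι] [DecidableEq ι]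
    (P : Finpartition (univ : Finset ι))
    (T : ∀ B : {B // B ∈ P.parts}, ⨂[ℝ] _ : {j // j ∈ B.1}, V) (f : ι → Fin n) :
    tensorCoord e f (placedProduct e P T) =
      ∏ B : {B // B ∈ P.parts}, tensorCoord e (fun j : {j // j ∈ B.1} => f j) (T B) := by
  have hbasis : ∀ g : ι → Fin n,
      tensorCoord e f (PiTensorProduct.tprod ℝ fun j => e (g j)) = if g = f then 1 else 0 := by
    intro g
    rw [tensorCoord_tprod]
    simp only [OrthonormalBasis.repr_self, PiLp.single_apply]
    rw [Fintype.prod_ite_zero]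
    simp [funext_iff, eq_comm]
  simp only [placedProduct, _root_.sum_apply, MultilinearMap.smulRight_apply,
    MultilinearMap.compLinearMap_apply, MultilinearMap.mkPiAlgebra_apply, map_sum, map_smul,
    hbasis, smul_eq_mul, mul_ite, mul_one, mul_zero, sum_ite_eq', mem_univ, if_true]
  rfl

/-- The sum over all index choices for the pairs factors, by distributivity, into one sum per pair.
-/
theorem tensorCoord_pairingInvariant {ι : Type*} [Fintype ι] [DecidableEq ι] (Q : Pairing ι)
    (f : ι → Fin n) :
    tensorCoord e f (pairingInvariant e Q) =
      ∏ p ∈ Q.1.parts, ∑ r : Fin n, ∏ j ∈ p, if f j = r then (1 : ℝ) else 0 := by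
  rw [← prod_coe_sort Q.1.parts fun p => ∑ r : Fin n, ∏ j ∈ p, if f j = r then (1 : ℝ) else 0,
    Fintype.prod_sum, pairingInvariant, map_sum]
  refine sum_congr rfl fun i _ => ?_
  rw [tensorCoord_blockTensor]
  refine prod_congr rfl fun p _ => ?_
  rw [← prod_coe_sort p.1 fun j => if f j = i p then (1 : ℝ) else 0]
  simp only [OrthonormalBasis.repr_self, PiLp.single_apply]

theorem sum_tensorCoord_pairingInvariant {ι : Type*} [Fintype ι] [DecidableEq ι]
    (f : ι → Fin n) :
    ∑ Q : Pairing ι, tensorCoord e f (pairingInvariant e Q) =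
      pairingSum (fun p => ∑ r : Fin n, ∏ j ∈ p, if f j = r then (1 : ℝ) else 0) univ := by
  simp only [tensorCoord_pairingInvariant]
  exact sum_pairing_eq fun 𝒬 : Finset (Finset ι) =>
    ∏ p ∈ 𝒬, ∑ r : Fin n, ∏ j ∈ p, if f j = r then (1 : ℝ) else 0

/-- An expectation can be checked on the coordinates. -/
theorem hasExpectation_of_tensorCoord {ι : Type*} [Fintype ι] [DecidableEq ι]
    {Ω : Type*} [MeasurableSpace Ω] {μ : Measure Ω} {X : Ω → ⨂[ℝ] _ : ι, V} {T : ⨂[ℝ] _ : ι, V}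
    (hint : ∀ f : ι → Fin n, Integrable (fun ω => tensorCoord e f (X ω)) μ)
    (h : ∀ f : ι → Fin n, ∫ ω, tensorCoord e f (X ω) ∂μ = tensorCoord e f T) :
    HasExpectation μ X T := by
  intro φ
  have hφ : ∀ S : ⨂[ℝ] _ : ι, V, φ S = ∑ f : ι → Fin n,
      tensorCoord e f S * φ (PiTensorProduct.tprod ℝ fun j => e (f j)) := by
    intro S
    conv_lhs => rw [← sum_tensorCoord_smul e S]
    simp only [map_sum, map_smul, smul_eq_mul]
  simp only [hφ (X _), hφ T]
  refine ⟨integrable_finsetSum _ fun f _ => (hint f).mul_const _, ?_⟩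
  rw [integral_finsetSum _ fun f _ => (hint f).mul_const _]
  simp only [integral_mul_const, h]

theorem continuous_coordinates : Continuous fun (v : V) (l : Fin n) => e.repr v l :=
  (PiLp.continuous_ofLp 2 _).comp e.repr.continuous

end Coordinates

/-! ### From orthogonal invariance to coordinates -/

section RandomVectors

variable {V : Type*} [NormedAddCommGroup V] [InnerProductSpace ℝ V] [MeasurableSpace V]
  [BorelSpace V] {n : ℕ} (e : OrthonormalBasis (Fin n) ℝ V)
  {Ω : Type*} [MeasurableSpace Ω] {μ : Measure Ω} {x : Ω → Metric.sphere (0 : V) 1}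

theorem IsInvariantRandomUnitVector.integral_comp (hx : IsInvariantRandomUnitVector μ x)
    (g : V ≃ₗᵢ[ℝ] V) {F : V → ℝ} (hF : Continuous F) :
    ∫ ω, F (g (x ω)) ∂μ = ∫ ω, F (x ω) ∂μ := by
  have hm : Measurable fun ω => (x ω : V) := measurable_subtype_coe.comp hx.1
  have h1 := integral_map (μ := μ) (φ := fun ω => g (x ω : V)) (f := F)
    (g.continuous.measurable.comp hm).aemeasurable hF.aestronglyMeasurable
  have h2 := integral_map (μ := μ) (φ := fun ω => (x ω : V)) (f := F)
    hm.aemeasurable hF.aestronglyMeasurable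
  rw [← h1, ← h2, hx.2 g]

theorem IsInvariantRandomUnitVector.isReflectionInvariant
    (hx : IsInvariantRandomUnitVector μ x) :
    IsReflectionInvariant μ fun ω l => e.repr (x ω : V) l where
  measurable := (continuous_coordinates e).measurable.comp (measurable_subtype_coe.comp hx.1)
  sum_sq ω := by
    have h := EuclideanSpace.real_norm_sq_eq (e.repr (x ω : V))
    rw [LinearIsometryEquiv.norm_map, norm_eq_of_mem_sphere] at h
    rw [← h, one_pow]
  integral_comp w hw F hF := by
    -- The unit vector with coordinates `w`; reflection in its line is `v ↦ 2 ⟨u, v⟩ u - v`.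
    set u : V := e.repr.symm (WithLp.toLp 2 w) with hu
    have hur : ∀ l, e.repr u l = w l := fun l => by simp [hu]
    have hnorm : ‖u‖ ^ 2 = 1 := by
      rw [hu, LinearIsometryEquiv.norm_map, EuclideanSpace.real_norm_sq_eq, ← hw]
    refine Eq.trans ?_ (hx.integral_comp (Submodule.reflection (ℝ ∙ u))
      (hF.comp (continuous_coordinates e)))
    refine integral_congr_ae (ae_of_all _ fun ω => ?_)
    simp only [Function.comp]
    congr 1
    funext l
    have hin : inner ℝ u (x ω : V) = ∑ r, w r * e.repr (x ω : V) r := by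
      rw [← e.repr.inner_map_map, PiLp.inner_apply]
      simp [hur, mul_comm]
    rw [Submodule.reflection_singleton_apply, hin]
    simp [lineReflection, hnorm, hur]
    ring

theorem IsInvariantRandomUnitVector.integral_neg (hx : IsInvariantRandomUnitVector μ x)
    {F : (Fin n → ℝ) → ℝ} (hF : Continuous F) :
    ∫ ω, F (-fun l => e.repr (x ω : V) l) ∂μ = ∫ ω, F (fun l => e.repr (x ω : V) l) ∂μ := by
  refine Eq.trans ?_
    (hx.integral_comp (LinearIsometryEquiv.neg ℝ) (hF.comp (continuous_coordinates e)))
  refine integral_congr_ae (ae_of_all _ fun ω => ?_)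
  simp only [Function.comp]
  congr 1
  funext l
  simp

end RandomVectors

theorem risingEvenProduct_ne_zero {n : ℕ} (hn : n ≠ 0) (k : ℕ) : risingEvenProduct n k ≠ 0 :=
  prod_ne_zero_iff.2 fun _ _ => by positivity

end VeroneseTensor

/-! ### The expectation of the decomposable tensor -/

open VeroneseTensor in
theorem theorem2 {V : Type*} [NormedAddCommGroup V] [InnerProductSpace ℝ V]
    [MeasurableSpace V] [BorelSpace V] {n : ℕ} (e : OrthonormalBasis (Fin n) ℝ V)
    {Ω : Type*} [MeasurableSpace Ω] (μ : Measure Ω) [IsProbabilityMeasure μ]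
    {m : ℕ} (P : Finpartition (univ : Finset (Fin m)))
    (x : {B // B ∈ P.parts} → Ω → Metric.sphere (0 : V) 1)
    (hx : ∀ B, IsInvariantRandomUnitVector μ (x B)) (hindep : iIndepFun x μ) :
    ((∃ B ∈ P.parts, Odd #B) →
      HasExpectation μ (fun ω => blockTensor P fun B => (x B ω : V)) 0) ∧
    (∀ k : {B // B ∈ P.parts} → ℕ, (∀ B, #B.1 = 2 * k B) →
      (∀ B, Fintype.card (Pairing {j // j ∈ B.1}) = Nat.doubleFactorial (2 * k B - 1)) ∧
      HasExpectation μ (fun ω => blockTensor P fun B => (x B ω : V))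
        ((∏ B, (Nat.doubleFactorial (2 * k B - 1) : ℝ) / risingEvenProduct n (k B)) •
          (1 / (Fintype.card (∀ B : {B // B ∈ P.parts}, Pairing {j // j ∈ B.1}) : ℝ)) •
            ∑ Q : ∀ B : {B // B ∈ P.parts}, Pairing {j // j ∈ B.1},
              placedProduct e P fun B => pairingInvariant e (Q B))) := by
  have hcont : ∀ (f : Fin m → Fin n) (B : {B // B ∈ P.parts}),
      Continuous fun v : Metric.sphere (0 : V) 1 =>
        ∏ j : {j // j ∈ B.1}, e.repr (v : V) (f j) := fun f B =>
    continuous_finsetProd _ fun j _ =>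
      (continuous_apply (f j)).comp ((continuous_coordinates e).comp continuous_subtype_val)
  have hB : ∀ B, IsReflectionInvariant μ fun ω l => e.repr (x B ω : V) l :=
    fun B => (hx B).isReflectionInvariant e
  have hmeas : ∀ (f : Fin m → Fin n) (B : {B // B ∈ P.parts}),
      Measurable fun ω => ∏ j : {j // j ∈ B.1}, e.repr (x B ω : V) (f j) :=
    fun f B => (hcont f B).measurable.comp (hx B).1
  have hint : ∀ f : Fin m → Fin n, Integrable
      (fun ω => tensorCoord e f (blockTensor P fun B => (x B ω : V))) μ := by
    intro f
    simp only [tensorCoord_blockTensor]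
    refine Integrable.of_bound
      (Finset.measurable_fun_prod _ fun B _ => hmeas f B).aestronglyMeasurable 1
      (ae_of_all _ fun ω => ?_)
    simp only [norm_prod]
    exact prod_le_one (fun _ _ => prod_nonneg fun _ _ => norm_nonneg _) fun B _ =>
      prod_le_one (fun _ _ => norm_nonneg _) fun j _ => (hB B).abs_le_one ω (f j)
  have hprod : ∀ f : Fin m → Fin n,
      ∫ ω, tensorCoord e f (blockTensor P fun B => (x B ω : V)) ∂μ =
        ∏ B, ∫ ω, ∏ j : {j // j ∈ B.1}, e.repr (x B ω : V) (f j) ∂μ := by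
    intro f
    simp only [tensorCoord_blockTensor]
    have hi := hindep.comp (fun B v => ∏ j : {j // j ∈ B.1}, e.repr (v : V) (f j))
      fun B => (hcont f B).measurable
    exact hi.integral_fun_prod_eq_prod_integral fun B => (hmeas f B).aestronglyMeasurable
  refine ⟨?_, fun k hk => ?_⟩
  · rintro ⟨B, hBP, hodd⟩
    refine hasExpectation_of_tensorCoord e hint fun f => ?_
    rw [hprod, map_zero]
    refine prod_eq_zero (mem_univ ⟨B, hBP⟩) ?_
    exact integral_prod_eq_zero_of_odd (fun F hF => (hx ⟨B, hBP⟩).integral_neg e hF)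
      (by simpa using hodd) _
  · have hcard : ∀ B, Fintype.card (Pairing {j // j ∈ B.1}) =
        Nat.doubleFactorial (2 * k B - 1) := fun B =>
      card_pairing (by rw [Fintype.card_coe, hk B])
    refine ⟨hcard, hasExpectation_of_tensorCoord e hint fun f => ?_⟩
    have hmoment : ∀ B : {B // B ∈ P.parts},
        ∫ ω, ∏ j : {j // j ∈ B.1}, e.repr (x B ω : V) (f j) ∂μ =
          (∑ Q : Pairing {j // j ∈ B.1},
            tensorCoord e (fun j : {j // j ∈ B.1} => f j) (pairingInvariant e Q)) /
              risingEvenProduct n (k B) := by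
      intro B
      -- In dimension 0 there is no unit vector, while a probability space is non-empty.
      have hn : n ≠ 0 := by
        rintro rfl
        obtain ⟨ω⟩ := nonempty_of_isProbabilityMeasure μ
        simpa using (hB B).sum_sq ω
      rw [sum_tensorCoord_pairingInvariant, eq_div_iff (risingEvenProduct_ne_zero hn _), mul_comm]
      exact (hB B).moment_eq_pairingSum (fun j : {j // j ∈ B.1} => f j) (k B) univ
        (by rw [card_univ, Fintype.card_coe, hk B])
    -- The double factorials multiply to the number of families of pairings, so they cancel and only
    -- the factors `1 / P(n, k B)` remain.
    have hne : (∏ B, (Nat.doubleFactorial (2 * k B - 1) : ℝ)) ≠ 0 :=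
      prod_ne_zero_iff.2 fun B _ => by exact_mod_cast (Nat.doubleFactorial_pos _).ne'
    rw [hprod]
    simp only [map_smul, map_sum, tensorCoord_placedProduct, smul_eq_mul, hmoment,
      Fintype.card_pi, hcard, Nat.cast_prod, prod_div_distrib, Fintype.prod_sum]
    field_simp
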